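/- Let $\mathcal N=\mathbb N^{\mathbb N}$ be the Baire space. For a finite sequence $s$ of natural numbers let $N_s=\{x\in\mathcal N : x \text{ extends } s\}$. A set $U\subseteq\mathcal N\times\mathcal N$ is (lightface) $\Sigma^0_1$ if $U=\bigcup_{(s,t)\in W}N_s\times N_t$ for some recursively enumerable set $W$ of pairs of finite sequences; its complement is then called $\Pi^0_1$. A set $A\subseteq\mathcal N$ is (lightface) $\Sigma^1_1$ if $A=\{x : \exists y\,(x,y)\in F\}$ for some $\Pi^0_1$ set $F\subseteq\mathcal N\times\mathcal N$; it is $\Pi^1_1$ if its complement is $\Sigma^1_1$, and $\Delta^1_1$ if it is both $\Sigma^1_1$ and $\Pi^1_1$. Let the $\Delta$-topology be the topology on $\mathcal N$ generated by the $\Delta^1_1$ sets, and let the $\Sigma\Delta$-topology be the topology on $\mathcal N$ generated by the $\Sigma^1_1$ sets that are closed in the $\Delta$-topology. Theorem. The $\Delta^1_1$ subsets of $\mathcal N$ form a basis of the $\Delta$-topology; the $\Sigma^1_1$ sets that are closed in the $\Delta$-topology form a basis of the $\Sigma\Delta$-topology; the $\Sigma\Delta$-topology is finer than (contains) the $\Delta$-topology;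 and the $\Delta$-topology and the $\Sigma\Delta$-topology are both Polish. -/

import Mathlib

namespace EffectiveDST

/-- The real `x` of the Baire space `ℕ → ℕ` extends the finite sequence `s`, that is, `x` lies in
the basic clopen neighbourhood `N_s`. -/
def Extends (x : ℕ → ℕ) (s : List ℕ) : Prop :=
  ∀ (i : ℕ) (hi : i < s.length), x i = s[i]

/-- Lightface `Σ⁰₁` (semirecursive, effectively open) subsets of the product of two copies of the
Baire space: the unions of recursively enumerable families of basic neighbourhoods `N_s × N_t`. -/
def IsSigma01Prod (U : Set ((ℕ → ℕ) × (ℕ → ℕ))) : Prop :=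
  ∃ W : List ℕ × List ℕ → Prop, REPred W ∧
    U = {z | ∃ s t : List ℕ, W (s, t) ∧ Extends z.1 s ∧ Extends z.2 t}

/-- Lightface `Π⁰₁` (effectively closed) subsets: the complements of the lightface `Σ⁰₁` sets. -/
def IsPi01Prod (F : Set ((ℕ → ℕ) × (ℕ → ℕ))) : Prop :=
  IsSigma01Prod Fᶜ

/-- Lightface `Σ¹₁` subsets of the Baire space: the projections of lightface `Π⁰₁` sets. -/
def IsSigma11 (A : Set (ℕ → ℕ)) : Prop :=
  ∃ F : Set ((ℕ → ℕ) × (ℕ → ℕ)), IsPi01Prod F ∧ A = {x | ∃ y, (x, y) ∈ F}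

/-- Lightface `Π¹₁` subsets of the Baire space: the complements of the lightface `Σ¹₁` sets. -/
def IsPi11 (A : Set (ℕ → ℕ)) : Prop :=
  IsSigma11 Aᶜ

/-- Lightface `Δ¹₁` subsets of the Baire space. -/
def IsDelta11 (A : Set (ℕ → ℕ)) : Prop :=
  IsSigma11 A ∧ IsPi11 A

/-- The `Δ`-topology on the Baire space, generated by the lightface `Δ¹₁` sets. -/
abbrev deltaTopology : TopologicalSpace (ℕ → ℕ) :=
  TopologicalSpace.generateFrom {D | IsDelta11 D}

/-- The `ΣΔ`-topology on the Baire space, generated by the lightface `Σ¹₁` sets that are closed in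
the `Δ`-topology. -/
abbrev sigmaDeltaTopology : TopologicalSpace (ℕ → ℕ) :=
  TopologicalSpace.generateFrom {A | IsSigma11 A ∧ @IsClosed (ℕ → ℕ) deltaTopology A}

end EffectiveDST

namespace EffectiveDST

/-! Every `Δ¹₁` set `D` has the form `{x | v x i ≠ 0}` for a fixed index `i` and a function `v`
whose graph is lightface `Π⁰₁`. To see this, take trees `S` for `D` and `T` for its complement. For
fixed `x`, two players alternately extend a sequence each, and whoever leaves his tree loses. No `x`
has branches through both trees, so every play is finite. Backward induction then yields exactly one
valuation of the positions that names the least winning moves. Being a valuation is a local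
condition, hence `Π⁰₁`, and its value at the empty position decides whether `x ∈ D`
(`IsDelta11.exists_unique_witness`).

Adjoining to a Polish topology countably many functions with closed graphs leaves it Polish
(`polishSpace_induced_of_isClosed_graph`). For the functions `v` this gives the `Δ`-topology: unique
witnesses make the sets `{x | v x n = k}` `Δ¹₁`, and `D` is one condition on `v x`. For the
`ΣΔ`-topology the base is the `Δ`-topology. A `Δ`-closed `A` is the zero fibre of a function to `ℕ`
whose other fibres are `Δ`-clopen, because `Aᶜ` is a countable union of `Δ¹₁` sets. -/

/-! ### Initial segments and trees for `Π⁰₁` sets -/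

/-- The initial segment of length `n` of a real. -/
def initSeg (x : ℕ → ℕ) (n : ℕ) : List ℕ := (List.range n).map x

@[simp] theorem length_initSeg (x : ℕ → ℕ) (n : ℕ) : (initSeg x n).length = n := by
  simp [initSeg]

theorem initSeg_getD (x : ℕ → ℕ) {n i : ℕ} (h : i < n) (d : ℕ) : (initSeg x n).getD i d = x i := by
  simp [initSeg, List.getD, h]

theorem take_initSeg (x : ℕ → ℕ) {m n : ℕ} (h : m ≤ n) : (initSeg x n).take m = initSeg x m := by
  apply List.ext_getElem
  · simp [h]
  · intro i h₁ h₂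
    simp [initSeg]

theorem extends_iff_initSeg_eq (x : ℕ → ℕ) (s : List ℕ) :
    Extends x s ↔ initSeg x s.length = s := by
  constructor
  · intro h
    apply List.ext_getElem
    · simp
    · intro i h₁ h₂
      simp [initSeg, h i h₂]
  · intro h i hi
    have := congrArg (fun l => l.getD i 0) h
    simp only [initSeg_getD x hi] at this
    rw [this, List.getD_eq_getElem _ _ hi]

theorem extends_iff_prefix_initSeg (x : ℕ → ℕ) {s : List ℕ} {n : ℕ} (h : s.length ≤ n) :
    Extends x s ↔ s <+: initSeg x n := by
  rw [List.prefix_iff_eq_take, take_initSeg x h, extends_iff_initSeg_eq, eq_comm]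

theorem initSeg_prefix (x : ℕ → ℕ) {m n : ℕ} (h : m ≤ n) : initSeg x m <+: initSeg x n := by
  rw [List.prefix_iff_eq_take, length_initSeg, take_initSeg x h]

theorem isPi01Prod_of_tree {T : List ℕ × List ℕ → Prop} (hT : PrimrecPred T) :
    IsPi01Prod {z | ∀ n, T (initSeg z.1 n, initSeg z.2 n)} := by
  refine ⟨fun a => a.1.length = a.2.length ∧ ¬ T a, ?_, ?_⟩
  · have h : PrimrecPred fun a : List ℕ × List ℕ => a.1.length = a.2.length ∧ ¬ T a :=
      (Primrec.eq.comp (Primrec.list_length.comp Primrec.fst)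
        (Primrec.list_length.comp Primrec.snd)).and hT.not
    obtain ⟨_, h⟩ := h
    exact ComputablePred.to_re ⟨_, h.to_comp⟩
  · ext ⟨x, y⟩
    simp only [Set.mem_compl_iff, Set.mem_ofPred_eq, not_forall]
    constructor
    · rintro ⟨n, hn⟩
      exact ⟨_, _, ⟨by simp, hn⟩, by simp [extends_iff_initSeg_eq], by simp [extends_iff_initSeg_eq]⟩
    · rintro ⟨s, t, ⟨hl, hn⟩, hs, ht⟩
      rw [extends_iff_initSeg_eq] at hs ht
      refine ⟨s.length, ?_⟩
      rw [hs, hl, ht]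
      exact hn

theorem _root_.REPred.exists_primrecRel {α : Type*} [Primcodable α] {p : α → Prop} (hp : REPred p) :
    ∃ R : ℕ → α → Prop, PrimrecRel R ∧ ∀ a, p a ↔ ∃ k, R k a := by
  obtain ⟨c, hc⟩ := Nat.Partrec.Code.exists_code.1 hp
  refine ⟨fun k a => (Nat.Partrec.Code.evaln k c (Encodable.encode a)).isSome = true, ?_, ?_⟩
  · have h : Primrec fun q : ℕ × α =>
        (Nat.Partrec.Code.evaln q.1 c (Encodable.encode q.2)).isSome :=
      Primrec.option_isSome.comp (Nat.Partrec.Code.primrec_evaln.comp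
        ((Primrec.fst.pair (Primrec.const c)).pair (Primrec.encode.comp Primrec.snd)))
    exact Primrec.eq.comp h (Primrec.const true)
  · intro a
    have h : (Nat.Partrec.Code.eval c (Encodable.encode a)).Dom ↔ p a := by
      rw [hc]
      simp [Part.assert]
    rw [← h, Part.dom_iff_mem]
    simp only [Nat.Partrec.Code.evaln_complete, Option.isSome_iff_exists, Option.mem_def]
    exact exists_comm

/-- Level `n` of the tree consults only the first `n` stages of the enumeration of `W`. This makes
membership primitive recursive and keeps the tree closed under initial segments. -/
theorem IsPi01Prod.exists_tree {F : Set ((ℕ → ℕ) × (ℕ → ℕ))} (hF : IsPi01Prod F) :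
    ∃ T : List ℕ × List ℕ → Prop, PrimrecPred T ∧
      (∀ x y m n, m ≤ n → T (initSeg x n, initSeg y n) → T (initSeg x m, initSeg y m)) ∧
      ∀ x y, (x, y) ∈ F ↔ ∀ n, T (initSeg x n, initSeg y n) := by
  obtain ⟨W, hW, hFW⟩ := hF
  obtain ⟨R, hR, hWR⟩ := hW.exists_primrecRel
  let u : ℕ → List ℕ × List ℕ := fun j => Denumerable.ofNat (List ℕ × List ℕ) j.unpair.2
  have hu : Primrec u :=
    (Primrec.ofNat (List ℕ × List ℕ)).comp (Primrec.snd.comp Primrec.unpair)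
  let Q : ℕ → List ℕ × List ℕ → Prop := fun j a =>
    ¬ (((u j).1 = a.1.take (u j).1.length ∧ (u j).2 = a.2.take (u j).2.length) ∧
      R j.unpair.1 (u j))
  have hQ : PrimrecRel Q := by
    have h₁ : Primrec fun q : ℕ × (List ℕ × List ℕ) => (u q.1).1 :=
      Primrec.fst.comp (hu.comp Primrec.fst)
    have h₂ : Primrec fun q : ℕ × (List ℕ × List ℕ) => (u q.1).2 :=
      Primrec.snd.comp (hu.comp Primrec.fst)
    refine PrimrecPred.not (((Primrec.eq.comp h₁ (Primrec.list_take.comp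
      (Primrec.list_length.comp h₁) (Primrec.fst.comp Primrec.snd))).and
      (Primrec.eq.comp h₂ (Primrec.list_take.comp
      (Primrec.list_length.comp h₂) (Primrec.snd.comp Primrec.snd)))).and ?_)
    exact hR.comp (Primrec.fst.comp (Primrec.unpair.comp Primrec.fst)) (hu.comp Primrec.fst)
  refine ⟨fun a => ∀ j < a.1.length, Q j a, ?_, ?_, ?_⟩
  · exact ((PrimrecRel.forall_mem_list hQ).comp
      (Primrec.list_range.comp (Primrec.list_length.comp Primrec.fst)) Primrec.id).of_eq
      fun a => by simp only [List.mem_range, id]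
  · intro x y m n hmn h j hj
    simp only [length_initSeg] at h hj
    rintro ⟨⟨h₁, h₂⟩, h₃⟩
    refine h j (hj.trans_le hmn) ⟨⟨?_, ?_⟩, h₃⟩
    · rw [← List.prefix_iff_eq_take] at h₁ ⊢
      exact h₁.trans (initSeg_prefix x hmn)
    · rw [← List.prefix_iff_eq_take] at h₂ ⊢
      exact h₂.trans (initSeg_prefix y hmn)
  · intro x y
    rw [← not_iff_not, ← Set.mem_compl_iff, hFW]
    simp only [Set.mem_ofPred_eq, not_forall, length_initSeg]
    constructor
    · rintro ⟨s, t, hst, hs, ht⟩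
      obtain ⟨k, hk⟩ := (hWR _).1 hst
      let j := Nat.pair k (Encodable.encode (s, t))
      have hj : u j = (s, t) := by simp only [u, j, Nat.unpair_pair, Denumerable.ofNat_encode]
      refine ⟨j + 1 + s.length + t.length, j, by omega, ?_⟩
      simp only [Q, hj, not_not, ← List.prefix_iff_eq_take]
      refine ⟨⟨(extends_iff_prefix_initSeg x (by omega)).1 hs,
        (extends_iff_prefix_initSeg y (by omega)).1 ht⟩, ?_⟩
      simpa [j] using hk
    · rintro ⟨n, j, -, hj⟩
      simp only [Q, not_not, ← List.prefix_iff_eq_take] at hj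
      refine ⟨(u j).1, (u j).2, (hWR _).2 ⟨_, hj.2⟩, ?_, ?_⟩
      · exact (extends_iff_prefix_initSeg x (by simpa using hj.1.1.length_le)).2 hj.1.1
      · exact (extends_iff_prefix_initSeg y (by simpa using hj.1.2.length_le)).2 hj.1.2

/-! ### Closure properties and countability of the lightface classes -/

theorem IsPi01Prod.inter {F G : Set ((ℕ → ℕ) × (ℕ → ℕ))} (hF : IsPi01Prod F)
    (hG : IsPi01Prod G) : IsPi01Prod (F ∩ G) := by
  obtain ⟨S, hS, -, hFS⟩ := hF.exists_tree
  obtain ⟨T, hT, -, hGT⟩ := hG.exists_tree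
  convert isPi01Prod_of_tree (hS.and hT) using 1
  ext ⟨x, y⟩
  simp only [Set.mem_inter_iff, hFS, hGT, Set.mem_ofPred_eq, forall_and]

theorem IsPi01Prod.union {F G : Set ((ℕ → ℕ) × (ℕ → ℕ))} (hF : IsPi01Prod F)
    (hG : IsPi01Prod G) : IsPi01Prod (F ∪ G) := by
  obtain ⟨S, hS, hmS, hFS⟩ := hF.exists_tree
  obtain ⟨T, hT, hmT, hGT⟩ := hG.exists_tree
  convert isPi01Prod_of_tree (hS.or hT) using 1
  ext ⟨x, y⟩
  simp only [Set.mem_union, hFS, hGT, Set.mem_ofPred_eq]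
  refine ⟨fun h n => h.imp (fun h => h n) fun h => h n, fun h => ?_⟩
  by_contra! hc
  obtain ⟨⟨m, hm⟩, n, hn⟩ := hc
  rcases h (max m n) with h | h
  · exact hm (hmS _ _ _ _ (le_max_left _ _) h)
  · exact hn (hmT _ _ _ _ (le_max_right _ _) h)

/-- The entries of a list at the positions `b`, `b + 2`, `b + 4`, … below `2 * (length / 2) + b`. -/
def alternate (b : ℕ) (t : List ℕ) : List ℕ :=
  (List.range (t.length / 2)).map fun i => t.getD (2 * i + b) 0

theorem primrec_alternate : Primrec₂ alternate := by
  have h : Primrec₂ fun (q : ℕ × List ℕ) (i : ℕ) => q.2.getD (2 * i + q.1) 0 :=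
    (Primrec.list_getD 0).comp (Primrec.snd.comp Primrec.fst)
      (Primrec.nat_add.comp (Primrec.nat_mul.comp (Primrec.const 2) Primrec.snd)
        (Primrec.fst.comp Primrec.fst))
  exact Primrec.list_map (Primrec.list_range.comp (Primrec.nat_div.comp
    (Primrec.list_length.comp Primrec.snd) (Primrec.const 2))) h

theorem alternate_initSeg {b : ℕ} (y : ℕ → ℕ) {n : ℕ} (hn : ∀ i < n / 2, 2 * i + b < n) :
    alternate b (initSeg y n) = initSeg (fun i => y (2 * i + b)) (n / 2) := by
  rw [alternate, length_initSeg, initSeg]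
  refine List.map_congr_left fun i hi => ?_
  exact initSeg_getD y (hn i (List.mem_range.1 hi)) 0

/-- Interleaving lets one real `y` carry two witnesses, as intersections of `Σ¹₁` sets require. -/
theorem IsPi01Prod.preimage_alternate {F : Set ((ℕ → ℕ) × (ℕ → ℕ))} (hF : IsPi01Prod F) {b : ℕ}
    (hb : b < 2) : IsPi01Prod {z | (z.1, fun i => z.2 (2 * i + b)) ∈ F} := by
  obtain ⟨T, hT, -, hFT⟩ := hF.exists_tree
  have h : PrimrecPred fun a : List ℕ × List ℕ =>
      T (a.1.take (a.1.length / 2), alternate b a.2) :=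
    hT.comp ((Primrec.list_take.comp (Primrec.nat_div.comp (Primrec.list_length.comp Primrec.fst)
      (Primrec.const 2)) Primrec.fst).pair (primrec_alternate.comp (Primrec.const b) Primrec.snd))
  convert isPi01Prod_of_tree h using 1
  ext ⟨x, y⟩
  have hn : ∀ n, (initSeg x n).take ((initSeg x n).length / 2) = initSeg x (n / 2) := fun n => by
    rw [length_initSeg, take_initSeg x (Nat.div_le_self n 2)]
  have hm : ∀ n, alternate b (initSeg y n) = initSeg (fun i => y (2 * i + b)) (n / 2) := fun n =>
    alternate_initSeg y fun i hi => by omega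
  simp only [Set.mem_ofPred_eq, hFT, hn, hm]
  refine ⟨fun h n => h _, fun h n => ?_⟩
  simpa using h (2 * n)

theorem isPi01Prod_coordinate {p : ℕ × ℕ → Prop} (hp : PrimrecPred p) (i : ℕ) :
    IsPi01Prod {z | p (z.1 i, z.2 i)} := by
  have h : PrimrecPred fun a : List ℕ × List ℕ =>
      -- Short segments pass automatically, so that `p` is never tested on the default value of
      -- `getD`.
      a.1.length ≤ i ∨ p (a.1.getD i 0, a.2.getD i 0) :=
    (Primrec.nat_le.comp (Primrec.list_length.comp Primrec.fst) (Primrec.const i)).or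
      (hp.comp (((Primrec.list_getD 0).comp Primrec.fst (Primrec.const i)).pair
        ((Primrec.list_getD 0).comp Primrec.snd (Primrec.const i))))
  convert isPi01Prod_of_tree h using 1
  ext ⟨x, y⟩
  simp only [Set.mem_ofPred_eq, length_initSeg]
  constructor
  · intro h n
    refine (le_or_gt n i).imp id fun hi => ?_
    rwa [initSeg_getD x hi, initSeg_getD y hi]
  · intro h
    have := (h (i + 1)).resolve_left (by omega)
    rwa [initSeg_getD x i.lt_succ_self, initSeg_getD y i.lt_succ_self] at this

theorem IsPi01Prod.isClosed {F : Set ((ℕ → ℕ) × (ℕ → ℕ))} (hF : IsPi01Prod F) : IsClosed F := by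
  obtain ⟨W, -, hW⟩ := hF
  have hs : ∀ s, IsOpen {x : ℕ → ℕ | Extends x s} := fun s => by
    have : {x : ℕ → ℕ | Extends x s} = ⋂ i : Fin s.length, (fun x => x i) ⁻¹' {s[i]} := by
      ext x
      simp only [Extends, Set.mem_ofPred_eq, Set.mem_iInter, Set.mem_preimage,
        Set.mem_singleton_iff]
      exact ⟨fun h i => h i i.2, fun h i hi => h ⟨i, hi⟩⟩
    rw [this]
    exact isOpen_iInter_of_finite fun i => (isOpen_discrete _).preimage (continuous_apply _)
  rw [← isOpen_compl_iff, hW]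
  have : {z : (ℕ → ℕ) × (ℕ → ℕ) | ∃ s t : List ℕ, W (s, t) ∧ Extends z.1 s ∧ Extends z.2 t} =
      ⋃ (s : List ℕ) (t : List ℕ) (_ : W (s, t)), {x | Extends x s} ×ˢ {y | Extends y t} := by
    ext
    simp only [Set.mem_ofPred_eq, Set.mem_iUnion, Set.mem_prod, exists_prop]
  rw [this]
  exact isOpen_iUnion fun s => isOpen_iUnion fun t => isOpen_iUnion fun _ => (hs s).prod (hs t)

theorem IsSigma11.union {A B : Set (ℕ → ℕ)} (hA : IsSigma11 A) (hB : IsSigma11 B) :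
    IsSigma11 (A ∪ B) := by
  obtain ⟨F, hF, rfl⟩ := hA
  obtain ⟨G, hG, rfl⟩ := hB
  exact ⟨F ∪ G, hF.union hG, by ext x; simp [exists_or]⟩

theorem IsSigma11.inter {A B : Set (ℕ → ℕ)} (hA : IsSigma11 A) (hB : IsSigma11 B) :
    IsSigma11 (A ∩ B) := by
  obtain ⟨F, hF, rfl⟩ := hA
  obtain ⟨G, hG, rfl⟩ := hB
  refine ⟨_, (hF.preimage_alternate (b := 0) (by omega)).inter
    (hG.preimage_alternate (b := 1) (by omega)), ?_⟩
  ext x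
  constructor
  · rintro ⟨⟨y, hy⟩, z, hz⟩
    refine ⟨fun n => if n % 2 = 0 then y (n / 2) else z (n / 2), ?_, ?_⟩
    · simpa using hy
    · have h₁ : ∀ i, (2 * i + 1) % 2 = 1 := fun i => by omega
      have h₂ : ∀ i, (2 * i + 1) / 2 = i := fun i => by omega
      simpa [h₁, h₂] using hz
  · rintro ⟨y, hy, hz⟩
    exact ⟨⟨_, hy⟩, _, hz⟩

theorem IsDelta11.compl {A : Set (ℕ → ℕ)} (hA : IsDelta11 A) : IsDelta11 Aᶜ :=
  ⟨hA.2, by rw [IsPi11, compl_compl]; exact hA.1⟩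

theorem IsDelta11.inter {A B : Set (ℕ → ℕ)} (hA : IsDelta11 A) (hB : IsDelta11 B) :
    IsDelta11 (A ∩ B) :=
  ⟨hA.1.inter hB.1, by rw [IsPi11, Set.compl_inter]; exact hA.2.union hB.2⟩

theorem isSigma11_coordinate {p : ℕ → Prop} (hp : PrimrecPred p) (i : ℕ) :
    IsSigma11 {x | p (x i)} :=
  ⟨_, isPi01Prod_coordinate (hp.comp Primrec.fst) i, by ext; simp⟩

theorem isDelta11_coordinate {p : ℕ → Prop} (hp : PrimrecPred p) (i : ℕ) :
    IsDelta11 {x | p (x i)} :=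
  ⟨isSigma11_coordinate hp i, isSigma11_coordinate hp.not i⟩

theorem primrecPred_const (p : Prop) {α : Type*} [Primcodable α] : PrimrecPred fun _ : α => p := by
  classical exact ⟨fun _ => inferInstance, Primrec.const _⟩

theorem isDelta11_univ : IsDelta11 Set.univ := by
  simpa using isDelta11_coordinate (primrecPred_const True) 0

theorem isDelta11_empty : IsDelta11 ∅ := by
  simpa using isDelta11_univ.compl

theorem countable_rePred {α : Type*} [Primcodable α] : {p : α → Prop | REPred p}.Countable := by
  have h : ∀ p : {p : α → Prop | REPred p}, ∃ c : Nat.Partrec.Code, ∀ a,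
      (c.eval (Encodable.encode a)).Dom ↔ p.1 a := fun p => by
    obtain ⟨c, hc⟩ := Nat.Partrec.Code.exists_code.1 p.2
    refine ⟨c, fun a => ?_⟩
    rw [hc]
    simp [Part.assert]
  choose c hc using h
  refine Set.countable_coe_iff.1 (Function.Injective.countable (f := c) fun p q hpq => ?_)
  ext a
  rw [← hc p, ← hc q, hpq]

theorem countable_isSigma11 : {A : Set (ℕ → ℕ) | IsSigma11 A}.Countable := by
  refine ((countable_rePred (α := List ℕ × List ℕ)).image fun W =>
    {x : ℕ → ℕ | ∃ y, ¬ ∃ s t : List ℕ, W (s, t) ∧ Extends x s ∧ Extends y t}).mono ?_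
  rintro A ⟨F, ⟨W, hW, hFW⟩, rfl⟩
  refine ⟨W, hW, ?_⟩
  ext x
  refine exists_congr fun y => ?_
  rw [← not_not (a := (x, y) ∈ F), ← Set.mem_compl_iff F, hFW]
  rfl

/-! ### Valuations of well-founded games -/

/-- `v` is the valuation of the game on finite sequences in which a player to move at a position
satisfying `lost` loses: `v p = 0` if the player to move at `p` has lost, and `v p = m + 1` if `m`
is the least winning move. -/
def IsValuation (lost : List ℕ → Prop) (v : List ℕ → ℕ) : Prop :=
  ∀ p m, (v p = 0 → lost p ∨ v (p ++ [m]) ≠ 0) ∧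
    (v p = m + 1 → ¬ lost p ∧ v (p ++ [m]) = 0) ∧ (m + 1 < v p → v (p ++ [m]) ≠ 0)

/-- `q` is a one-move continuation of `p`, a position at which the play has not ended. -/
def IsMove (lost : List ℕ → Prop) (q p : List ℕ) : Prop :=
  ¬ lost p ∧ ∃ m, q = p ++ [m]

theorem exists_isValuation {lost : List ℕ → Prop} (h : WellFounded (IsMove lost)) :
    ∃ v, IsValuation lost v := by
  classical
  let φ : (p : List ℕ) → ((q : List ℕ) → IsMove lost q p → ℕ) → ℕ := fun p ih =>
    if hw : ∃ m, ∃ hl : ¬ lost p, ih (p ++ [m]) ⟨hl, m, rfl⟩ = 0 then Nat.find hw + 1 else 0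
  refine ⟨h.fix φ, fun p m => ?_⟩
  have hv : h.fix φ p = if hw : ∃ m, ¬ lost p ∧ h.fix φ (p ++ [m]) = 0 then Nat.find hw + 1
      else 0 := by
    rw [h.fix_eq]
    simp only [φ, exists_prop]
  by_cases hw : ∃ m, ¬ lost p ∧ h.fix φ (p ++ [m]) = 0
  · rw [dif_pos hw] at hv
    rw [hv]
    refine ⟨by simp, fun hm => ?_, fun hm h0 => ?_⟩
    · rw [← Nat.succ_injective hm]
      exact Nat.find_spec hw
    · exact Nat.find_min hw (Nat.lt_of_succ_lt_succ hm) ⟨(Nat.find_spec hw).1, h0⟩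
  · rw [dif_neg hw] at hv
    push Not at hw
    rw [hv]
    refine ⟨fun _ => ?_, by simp, by simp⟩
    by_cases hl : lost p
    · exact Or.inl hl
    · exact Or.inr (hw m hl)

theorem IsValuation.eq_zero_iff {lost : List ℕ → Prop} {v : List ℕ → ℕ} (hv : IsValuation lost v)
    (p : List ℕ) : v p = 0 ↔ lost p ∨ ∀ m, v (p ++ [m]) ≠ 0 := by
  constructor
  · intro h
    by_cases hl : lost p
    · exact Or.inl hl
    · exact Or.inr fun m => ((hv p m).1 h).resolve_left hl
  · intro h
    by_contra hp
    obtain ⟨k, hk⟩ := Nat.exists_eq_succ_of_ne_zero hp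
    have := (hv p k).2.1 hk
    exact h.elim this.1 fun h => h k this.2

/-- Asking for the least winning move, rather than any, is what forces uniqueness. -/
theorem IsValuation.unique {lost : List ℕ → Prop} (h : WellFounded (IsMove lost))
    {v w : List ℕ → ℕ} (hv : IsValuation lost v) (hw : IsValuation lost w) : v = w := by
  funext p
  induction p using h.induction with
  | _ p ih =>
    by_cases hl : lost p
    · rw [(hv.eq_zero_iff p).2 (Or.inl hl), (hw.eq_zero_iff p).2 (Or.inl hl)]
    · have ih' : ∀ m, v (p ++ [m]) = w (p ++ [m]) := fun m => ih _ ⟨hl, m, rfl⟩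
      have h0 : v p = 0 ↔ w p = 0 := by
        rw [hv.eq_zero_iff, hw.eq_zero_iff]
        simp only [ih']
      rcases hvp : v p with _ | k
      · exact (h0.1 hvp).symm
      · rcases hwp : w p with _ | l
        · exact absurd (h0.2 hwp) (by omega)
        · have h₁ := ((hv p k).2.1 hvp).2
          have h₂ := ((hw p l).2.1 hwp).2
          rcases lt_trichotomy k l with hkl | hkl | hkl
          · exact absurd ((ih' k).symm.trans h₁) ((hw p k).2.2 (by omega))
          · rw [hkl]
          · exact absurd ((ih' l).trans h₂) ((hv p l).2.2 (by omega))

/-- `turn` marks the positions where the player following the strategy is to move, `good` those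
consistent with it. He never loses on his turn, and since plays are finite, he wins. -/
theorem IsValuation.of_strategy {lost : List ℕ → Prop} (h : WellFounded (IsMove lost))
    {v : List ℕ → ℕ} (hv : IsValuation lost v) {turn good : List ℕ → Prop}
    (hturn : ∀ p m, turn (p ++ [m]) ↔ ¬ turn p)
    (hmine : ∀ p, good p → turn p → ¬ lost p ∧ ∃ m, good (p ++ [m]))
    (hother : ∀ p, good p → ¬ turn p → ∀ m, good (p ++ [m])) (p : List ℕ) (hp : good p) :
    turn p ↔ v p ≠ 0 := by
  induction p using h.induction with
  | _ p ih =>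
    rw [Ne, hv.eq_zero_iff, not_or, not_forall]
    constructor
    · intro ht
      obtain ⟨hl, m, hm⟩ := hmine p hp ht
      refine ⟨hl, m, fun h0 => ?_⟩
      exact (hturn p m).1 ((ih _ ⟨hl, m, rfl⟩ hm).2 h0) ht
    · rintro ⟨hl, m, hm⟩
      by_contra ht
      refine hm ((ih _ ⟨hl, m, rfl⟩ (hother p hp ht m)).1 ((hturn p m).2 ht))

/-! ### The game on two trees -/

/-- The moves made at position `p` by the player whose turn it is at `p`. -/
def ownMoves (p : List ℕ) : List ℕ := alternate (p.length % 2) p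

/-- The player to move at `p` has lost if his moves, paired with `x`, have left his tree; the
players use the trees `S` (first player) and `T` (second player). -/
def Lost (S T : List ℕ × List ℕ → Prop) (x : ℕ → ℕ) (p : List ℕ) : Prop :=
  ¬ ((p.length % 2 = 0 → S (initSeg x (p.length / 2), ownMoves p)) ∧
    (p.length % 2 = 1 → T (initSeg x (p.length / 2), ownMoves p)))

theorem ownMoves_initSeg (z : ℕ → ℕ) (n : ℕ) :
    ownMoves (initSeg z n) = initSeg (fun i => z (2 * i + n % 2)) (n / 2) := by
  rw [ownMoves, length_initSeg, alternate_initSeg]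
  intro i hi
  omega

theorem exists_initSeg_of_chain {f : ℕ → List ℕ} (hf : ∀ n, ∃ m, f (n + 1) = f n ++ [m]) :
    ∃ z : ℕ → ℕ, ∀ n, f n = initSeg z ((f 0).length + n) := by
  have hlen : ∀ n, (f n).length = (f 0).length + n := fun n => by
    induction n with
    | zero => rfl
    | succ n ih =>
      obtain ⟨m, hm⟩ := hf n
      rw [hm, List.length_append, ih]
      rfl
  have hpre : ∀ m n, m ≤ n → f m <+: f n := fun m n h => by
    induction n, h using Nat.le_induction with
    | base => exact List.prefix_rfl
    | succ n _ ih =>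
      obtain ⟨k, hk⟩ := hf n
      exact ih.trans (hk ▸ List.prefix_append _ _)
  refine ⟨fun i => (f (i + 1)).getD i 0, fun n => ?_⟩
  apply List.ext_getElem
  · rw [length_initSeg, hlen]
  · intro i h₁ h₂
    have hi : i < (f (i + 1)).length := by rw [hlen]; omega
    simp only [initSeg, List.getElem_map, List.getElem_range]
    rw [List.getD_eq_getElem _ _ hi]
    rcases le_total n (i + 1) with h | h
    · exact (hpre _ _ h).getElem h₁
    · exact ((hpre _ _ h).getElem hi).symm

section Game

variable {S T : List ℕ × List ℕ → Prop} {x : ℕ → ℕ}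

/-- The even and odd moves of an infinite play would be branches through `S` and `T`. -/
theorem wellFounded_isMove_lost
    (hS : ∀ x y m n, m ≤ n → S (initSeg x n, initSeg y n) → S (initSeg x m, initSeg y m))
    (hT : ∀ x y m n, m ≤ n → T (initSeg x n, initSeg y n) → T (initSeg x m, initSeg y m))
    (hST : ¬ ((∃ y, ∀ n, S (initSeg x n, initSeg y n)) ∧ ∃ y, ∀ n, T (initSeg x n, initSeg y n))) :
    WellFounded (IsMove (Lost S T x)) := by
  refine ⟨fun p => ?_⟩
  by_contra hp
  obtain ⟨f, -, hf⟩ := not_acc_iff_exists_descending_chain.1 hp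
  obtain ⟨z, hz⟩ := exists_initSeg_of_chain fun n => (hf n).2
  -- The descending chain starts at an arbitrary position, so nothing is known about shorter ones;
  -- closure of the trees under initial segments covers those.
  have hl : ∀ n, (f 0).length ≤ n → ¬ Lost S T x (initSeg z n) := fun n hn => by
    obtain ⟨k, rfl⟩ := Nat.exists_eq_add_of_le hn
    rw [← hz]
    exact (hf k).1
  refine hST ⟨⟨fun i => z (2 * i), fun n => ?_⟩, ⟨fun i => z (2 * i + 1), fun n => ?_⟩⟩
  · have := hl (2 * ((f 0).length + n)) (by omega)
    rw [Lost, not_not, length_initSeg, ownMoves_initSeg] at this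
    have := this.1 (by omega)
    simp only [Nat.mul_mod_right, Nat.mul_div_cancel_left _ two_pos] at this
    exact hS _ _ _ _ (by omega) this
  · have := hl (2 * ((f 0).length + n) + 1) (by omega)
    rw [Lost, not_not, length_initSeg, ownMoves_initSeg] at this
    have := this.2 (by omega)
    have h₁ : (2 * ((f 0).length + n) + 1) % 2 = 1 := by omega
    have h₂ : (2 * ((f 0).length + n) + 1) / 2 = (f 0).length + n := by omega
    simp only [h₁, h₂] at this
    exact hT _ _ _ _ (by omega) this

/-- The player of parity `b` wins by copying the branch `y`; `0 = b` says that he opens the game. -/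
theorem IsValuation.of_branch (hwf : WellFounded (IsMove (Lost S T x))) {v : List ℕ → ℕ}
    (hv : IsValuation (Lost S T x) v) {b : ℕ} (hb : b < 2) {y : ℕ → ℕ}
    (hS : b = 0 → ∀ n, S (initSeg x n, initSeg y n))
    (hT : b = 1 → ∀ n, T (initSeg x n, initSeg y n)) : 0 = b ↔ v [] ≠ 0 := by
  let good : List ℕ → Prop := fun p => ∀ i, 2 * i + b < p.length → p.getD (2 * i + b) 0 = y i
  have key := hv.of_strategy hwf (turn := fun p => p.length % 2 = b) (good := good) ?_ ?_ ?_ []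
    (by simp [good])
  · simpa using key
  · intro p m
    simp only [List.length_append, List.length_singleton]
    omega
  · intro p hp ht
    have hown : ownMoves p = initSeg y (p.length / 2) := by
      rw [ownMoves, alternate, initSeg]
      refine List.map_congr_left fun i hi => ?_
      rw [List.mem_range] at hi
      rw [ht]
      exact hp i (by omega)
    refine ⟨?_, y (p.length / 2), fun i hi => ?_⟩
    · rw [Lost, not_not, hown, ht]
      exact ⟨fun h => hS h _, fun h => hT h _⟩
    · rw [List.length_append, List.length_singleton] at hi
      rcases Nat.lt_or_ge (2 * i + b) p.length with h | h
      · rw [List.getD_append _ _ _ _ h]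
        exact hp i h
      · rw [List.getD_append_right _ _ _ _ h]
        have h₁ : 2 * i + b - p.length = 0 := by omega
        have h₂ : p.length / 2 = i := by omega
        rw [h₁, h₂]
        rfl
  · intro p hp ht m i hi
    rw [List.length_append, List.length_singleton] at hi
    have h : 2 * i + b < p.length := by
      by_contra
      refine ht ?_
      show p.length % 2 = b
      omega
    rw [List.getD_append _ _ _ _ h]
    exact hp i h

end Game

/-! ### Being a valuation is a `Π⁰₁` condition -/

/-- The condition on initial segments `a.1` of `x` and `a.2` of `v` that expresses the clause for
the position `p` and the move `m` of `IsValuation (Lost S T x)`. -/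
def ValuationClause (S T : List ℕ × List ℕ → Prop) (a : List ℕ × List ℕ) (p : List ℕ) (m : ℕ) :
    Prop :=
  let v : List ℕ → ℕ := fun q => a.2.getD (Encodable.encode q) 0
  let lost : Prop := ¬ ((p.length % 2 = 0 → S (a.1.take (p.length / 2), ownMoves p)) ∧
    (p.length % 2 = 1 → T (a.1.take (p.length / 2), ownMoves p)))
  (v p = 0 → lost ∨ v (p ++ [m]) ≠ 0) ∧
    (v p = m + 1 → ¬ lost ∧ v (p ++ [m]) = 0) ∧ (m + 1 < v p → v (p ++ [m]) ≠ 0)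

theorem _root_.PrimrecPred.imp {α : Type*} [Primcodable α] {p q : α → Prop} (hp : PrimrecPred p)
    (hq : PrimrecPred q) : PrimrecPred fun a => p a → q a :=
  (hp.not.or hq).of_eq fun _ => imp_iff_not_or.symm

theorem primrec_ownMoves : Primrec ownMoves :=
  primrec_alternate.comp (Primrec.nat_mod.comp Primrec.list_length (Primrec.const 2)) Primrec.id

theorem primrecPred_valuationClause {S T : List ℕ × List ℕ → Prop} (hS : PrimrecPred S)
    (hT : PrimrecPred T) : PrimrecPred fun q : (List ℕ × List ℕ) × List ℕ × ℕ =>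
      ValuationClause S T q.1 q.2.1 q.2.2 := by
  have hp : Primrec fun q : (List ℕ × List ℕ) × List ℕ × ℕ => q.2.1 :=
    Primrec.fst.comp Primrec.snd
  have hm : Primrec fun q : (List ℕ × List ℕ) × List ℕ × ℕ => q.2.2 :=
    Primrec.snd.comp Primrec.snd
  have hm' : Primrec fun q : (List ℕ × List ℕ) × List ℕ × ℕ => q.2.2 + 1 :=
    Primrec.succ.comp hm
  have hv : ∀ {f : (List ℕ × List ℕ) × List ℕ × ℕ → List ℕ}, Primrec f →
      Primrec fun q : (List ℕ × List ℕ) × List ℕ × ℕ => q.1.2.getD (Encodable.encode (f q)) 0 := fun hf =>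
    (Primrec.list_getD 0).comp (Primrec.snd.comp Primrec.fst) (Primrec.encode.comp hf)
  have hvp := hv hp
  have hvm := hv (Primrec.list_concat.comp hp hm)
  have hpar := Primrec.nat_mod.comp (Primrec.list_length.comp hp) (Primrec.const 2)
  have harg : Primrec fun q : (List ℕ × List ℕ) × List ℕ × ℕ =>
      (q.1.1.take (q.2.1.length / 2), ownMoves q.2.1) :=
    (Primrec.list_take.comp (Primrec.nat_div.comp (Primrec.list_length.comp hp) (Primrec.const 2))
      (Primrec.fst.comp Primrec.fst)).pair (primrec_ownMoves.comp hp)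
  have hlost := (((Primrec.eq.comp hpar (Primrec.const 0)).imp (hS.comp harg)).and
    ((Primrec.eq.comp hpar (Primrec.const 1)).imp (hT.comp harg))).not
  have h0 := Primrec.eq.comp hvm (Primrec.const 0)
  exact ((Primrec.eq.comp hvp (Primrec.const 0)).imp (hlost.or h0.not)).and
    (((Primrec.eq.comp hvp hm').imp (hlost.not.and h0)).and ((Primrec.nat_lt.comp hm' hvp).imp
      h0.not))

theorem isPi01Prod_isValuation {S T : List ℕ × List ℕ → Prop} (hS : PrimrecPred S)
    (hT : PrimrecPred T) :
    IsPi01Prod {z | IsValuation (Lost S T z.1) fun p => z.2 (Encodable.encode p)} := by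
  -- A level `n` codes padding, a position `u n` and a move `w n`; only that one clause is tested
  -- there, and only if the segments are long enough to evaluate it.
  let u : ℕ → List ℕ := fun n => Denumerable.ofNat (List ℕ) n.unpair.2.unpair.1
  let w : ℕ → ℕ := fun n => n.unpair.2.unpair.2
  have hu' : Primrec fun n : ℕ => n.unpair.2.unpair :=
    Primrec.unpair.comp (Primrec.snd.comp Primrec.unpair)
  have hu : Primrec u := (Primrec.ofNat (List ℕ)).comp (Primrec.fst.comp hu')
  have hw : Primrec w := Primrec.snd.comp hu'
  have hl : Primrec fun a : List ℕ × List ℕ => a.1.length := Primrec.list_length.comp Primrec.fst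
  have h : PrimrecPred fun a : List ℕ × List ℕ =>
      (Encodable.encode (u a.1.length) < a.1.length ∧
        Encodable.encode (u a.1.length ++ [w a.1.length]) < a.1.length ∧
        (u a.1.length).length / 2 ≤ a.1.length) →
      ValuationClause S T a (u a.1.length) (w a.1.length) := by
    refine PrimrecPred.imp (.and ?_ (.and ?_ ?_)) ?_
    · exact Primrec.nat_lt.comp (Primrec.encode.comp (hu.comp hl)) hl
    · exact Primrec.nat_lt.comp (Primrec.encode.comp
        (Primrec.list_concat.comp (hu.comp hl) (hw.comp hl))) hl
    · exact Primrec.nat_le.comp (Primrec.nat_div.comp (Primrec.list_length.comp (hu.comp hl))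
        (Primrec.const 2)) hl
    · exact (primrecPred_valuationClause hS hT).comp
        (Primrec.id.pair ((hu.comp hl).pair (hw.comp hl)))
  convert isPi01Prod_of_tree h using 1
  ext ⟨x, v⟩
  have key : ∀ n p m, Encodable.encode p < n → Encodable.encode (p ++ [m]) < n →
      p.length / 2 ≤ n → (ValuationClause S T (initSeg x n, initSeg v n) p m ↔
        (v (Encodable.encode p) = 0 → Lost S T x p ∨ v (Encodable.encode (p ++ [m])) ≠ 0) ∧
        (v (Encodable.encode p) = m + 1 → ¬ Lost S T x p ∧ v (Encodable.encode (p ++ [m])) = 0) ∧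
        (m + 1 < v (Encodable.encode p) → v (Encodable.encode (p ++ [m])) ≠ 0)) := by
    intro n p m h₁ h₂ h₃
    simp only [ValuationClause, initSeg_getD v h₁, initSeg_getD v h₂, take_initSeg x h₃, Lost]
  simp only [Set.mem_ofPred_eq, length_initSeg]
  constructor
  · rintro hv n ⟨h₁, h₂, h₃⟩
    exact (key _ _ _ h₁ h₂ h₃).2 (hv _ _)
  · intro hv p m
    -- The padding `k` pushes the level beyond every entry that the clause for `p` and `m` reads.
    let k := Encodable.encode p + Encodable.encode (p ++ [m]) + p.length + 1
    let n := Nat.pair k (Nat.pair (Encodable.encode p) m)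
    have hn : k ≤ n := Nat.left_le_pair _ _
    have hun : u n = p := by simp [u, n]
    have hwn : w n = m := by simp [w, n]
    have := hv n
    rw [hun, hwn] at this
    have h₁ : Encodable.encode p < n := by omega
    have h₂ : Encodable.encode (p ++ [m]) < n := by omega
    have h₃ : p.length / 2 ≤ n := by omega
    exact (key _ _ _ h₁ h₂ h₃).1 (this ⟨h₁, h₂, h₃⟩)

theorem IsDelta11.exists_unique_witness {D : Set (ℕ → ℕ)} (hD : IsDelta11 D) :
    ∃ F, IsPi01Prod F ∧ (∀ x, ∃! v, (x, v) ∈ F) ∧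
      ∃ i, ∀ x v, (x, v) ∈ F → (x ∈ D ↔ v i ≠ 0) := by
  obtain ⟨⟨G, hG, hDG⟩, H, hH, hDH⟩ := hD
  obtain ⟨S, hS, hmS, hGS⟩ := hG.exists_tree
  obtain ⟨T, hT, hmT, hHT⟩ := hH.exists_tree
  have hDS : ∀ x, x ∈ D ↔ ∃ y, ∀ n, S (initSeg x n, initSeg y n) := fun x => by
    rw [hDG]
    exact exists_congr fun y => hGS x y
  have hDT : ∀ x, x ∉ D ↔ ∃ y, ∀ n, T (initSeg x n, initSeg y n) := fun x => by
    rw [← Set.mem_compl_iff, hDH]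
    exact exists_congr fun y => hHT x y
  have hwf : ∀ x, WellFounded (IsMove (Lost S T x)) := fun x =>
    wellFounded_isMove_lost hmS hmT (by rw [← hDS, ← hDT]; exact and_not_self)
  refine ⟨_, isPi01Prod_isValuation hS hT, fun x => ?_, Encodable.encode ([] : List ℕ),
    fun x v hv => ?_⟩
  · obtain ⟨v, hv⟩ := exists_isValuation (hwf x)
    refine ⟨fun n => v (Denumerable.ofNat (List ℕ) n), ?_, fun w hw => ?_⟩
    · simpa using hv
    · funext n
      simpa using congrFun (IsValuation.unique (hwf x) hw hv) (Denumerable.ofNat (List ℕ) n)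
  · by_cases hx : x ∈ D
    · obtain ⟨y, hy⟩ := (hDS x).1 hx
      have := IsValuation.of_branch (hwf x) hv (b := 0) (y := y) (by omega) (fun _ => hy) (by simp)
      simpa [hx] using this
    · obtain ⟨y, hy⟩ := (hDT x).1 hx
      have := IsValuation.of_branch (hwf x) hv (b := 1) (y := y) (by omega) (by simp) (fun _ => hy)
      simpa [hx] using this

/-! ### Refining Polish topologies -/

open Topology

theorem isClosed_graph_of_isClosed_fibers {X : Type*} [TopologicalSpace X] {f : X → ℕ}
    (hf : ∀ n, IsClosed (f ⁻¹' {n})) : IsClosed {z : X × ℕ | f z.1 = z.2} := by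
  have : {z : X × ℕ | f z.1 = z.2}ᶜ = ⋃ n, (f ⁻¹' {n})ᶜ ×ˢ {n} := by
    ext ⟨x, n⟩
    simp
  rw [← isOpen_compl_iff, this]
  exact isOpen_iUnion fun n => (hf n).isOpen_compl.prod (isOpen_discrete _)

/-- The range of `x ↦ (x, (f i x)ᵢ)` is cut out by the closed graphs, so the map is a closed
embedding into a Polish product. -/
theorem polishSpace_induced_of_isClosed_graph {X ι : Type*} {Y : ι → Type*} [Countable ι]
    [TopologicalSpace X] [PolishSpace X] [∀ i, TopologicalSpace (Y i)] [∀ i, PolishSpace (Y i)]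
    (f : ∀ i, X → Y i) (hf : ∀ i, IsClosed {z : X × Y i | f i z.1 = z.2}) :
    @PolishSpace X (TopologicalSpace.induced (fun x => (x, fun i => f i x))
      instTopologicalSpaceProd) := by
  refine @IsClosedEmbedding.polishSpace X (X × ∀ i, Y i) (TopologicalSpace.induced _ _) _ _
    (fun x : X => (x, fun i => f i x))
    (@IsClosedEmbedding.mk _ _ (TopologicalSpace.induced _ _) _ _
      (@IsEmbedding.mk _ _ (TopologicalSpace.induced _ _) _ _
        (@IsInducing.mk _ _ (TopologicalSpace.induced _ _) _ _ rfl)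
        fun x y h => congrArg Prod.fst h) ?_)
  have : Set.range (fun x : X => (x, fun i => f i x)) =
      ⋂ i, (fun z : X × ∀ i, Y i => (z.1, z.2 i)) ⁻¹' {z | f i z.1 = z.2} := by
    ext ⟨x, y⟩
    simp only [Set.mem_range, Prod.mk.injEq, Set.mem_iInter, Set.mem_preimage, Set.mem_ofPred_eq]
    constructor
    · rintro ⟨x, rfl, rfl⟩ i
      rfl
    · exact fun h => ⟨x, rfl, funext h⟩
  rw [this]
  exact isClosed_iInter fun i => (hf i).preimage (by fun_prop)

/-! ### The `Δ`- and `ΣΔ`-topologies -/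

theorem isTopologicalBasis_deltaTopology :
    @TopologicalSpace.IsTopologicalBasis (ℕ → ℕ) deltaTopology {D | IsDelta11 D} :=
  letI := deltaTopology
  { exists_subset_inter := fun A hA B hB _ hx => ⟨A ∩ B, hA.inter hB, hx, subset_rfl⟩
    sUnion_eq := Set.eq_univ_of_univ_subset (Set.subset_sUnion_of_mem isDelta11_univ)
    eq_generateFrom := rfl }

theorem isOpen_deltaTopology {D : Set (ℕ → ℕ)} (hD : IsDelta11 D) : IsOpen[deltaTopology] D :=
  TopologicalSpace.isOpen_generateFrom_of_mem hD

theorem isClosed_deltaTopology {D : Set (ℕ → ℕ)} (hD : IsDelta11 D) :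
    IsClosed[deltaTopology] D :=
  @isOpen_compl_iff _ D deltaTopology |>.1 (isOpen_deltaTopology hD.compl)

theorem isTopologicalBasis_sigmaDeltaTopology :
    @TopologicalSpace.IsTopologicalBasis (ℕ → ℕ) sigmaDeltaTopology
      {A | IsSigma11 A ∧ IsClosed[deltaTopology] A} :=
  letI := sigmaDeltaTopology
  { exists_subset_inter := fun A hA B hB _ hx =>
      ⟨A ∩ B, ⟨hA.1.inter hB.1, @IsClosed.inter _ _ _ deltaTopology hA.2 hB.2⟩, hx, subset_rfl⟩
    sUnion_eq := Set.eq_univ_of_univ_subset (Set.subset_sUnion_of_mem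
      ⟨isDelta11_univ.1, isClosed_deltaTopology isDelta11_univ⟩)
    eq_generateFrom := rfl }

theorem sigmaDeltaTopology_le_deltaTopology : sigmaDeltaTopology ≤ deltaTopology :=
  le_generateFrom fun _ hD =>
    TopologicalSpace.isOpen_generateFrom_of_mem ⟨hD.1, isClosed_deltaTopology hD⟩

theorem continuous_nat_iff_isOpen_fibers {X : Type*} [TopologicalSpace X] {f : X → ℕ} :
    Continuous f ↔ ∀ n, IsOpen (f ⁻¹' {n}) :=
  continuous_discrete_rng

theorem polishSpace_deltaTopology : @PolishSpace (ℕ → ℕ) deltaTopology := by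
  let ι := {D : Set (ℕ → ℕ) | IsDelta11 D}
  have : Countable ι := (countable_isSigma11.mono fun D hD => hD.1).to_subtype
  choose F hF hu i hi using fun D : ι => IsDelta11.exists_unique_witness D.2
  choose v hv hvu using hu
  have hgraph : ∀ D, {z : (ℕ → ℕ) × (ℕ → ℕ) | v D z.1 = z.2} = F D := fun D => by
    ext ⟨x, y⟩
    exact ⟨fun h => (show v D x = y from h) ▸ hv D x, fun h => (hvu D x y h).symm⟩
  -- Since witnesses are unique, applying this to `p` and to its negation gives `Δ¹₁` sets.
  have hsigma : ∀ D n (p : ℕ → Prop), PrimrecPred p → IsSigma11 {x | p (v D x n)} :=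
    fun D n p hp => by
      refine ⟨_, (hF D).inter (isPi01Prod_coordinate (hp.comp Primrec.snd) n), ?_⟩
      ext x
      constructor
      · exact fun h => ⟨v D x, hv D x, h⟩
      · rintro ⟨y, hy, h⟩
        rw [hvu D x y hy] at h
        exact h
  have hdelta : ∀ D n k, IsDelta11 {x | v D x n = k} := fun D n k =>
    have hp : PrimrecPred fun m : ℕ => m = k := Primrec.eq.comp Primrec.id (Primrec.const k)
    ⟨hsigma D n _ hp, hsigma D n _ hp.not⟩
  convert polishSpace_induced_of_isClosed_graph v (fun D => by rw [hgraph]; exact (hF D).isClosed)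
    using 1
  apply le_antisymm
  · rw [← continuous_iff_le_induced]
    refine @Continuous.prodMk _ _ _ _ _ deltaTopology _ _ ?_ ?_
    · refine @continuous_pi _ _ _ deltaTopology _ _ fun n => ?_
      refine (@continuous_nat_iff_isOpen_fibers _ deltaTopology _).2 fun k => ?_
      exact isOpen_deltaTopology (isDelta11_coordinate
        (p := fun m => m = k) (Primrec.eq.comp Primrec.id (Primrec.const k)) n)
    · refine @continuous_pi _ _ _ deltaTopology _ _ fun D => ?_
      refine @continuous_pi _ _ _ deltaTopology _ _ fun n => ?_
      exact (@continuous_nat_iff_isOpen_fibers _ deltaTopology _).2 fun k =>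
        isOpen_deltaTopology (hdelta D n k)
  · refine le_generateFrom fun D hD => ?_
    have : D = (fun x : ℕ → ℕ => (x, fun D => v D x)) ⁻¹'
        {z | z.2 ⟨D, hD⟩ (i ⟨D, hD⟩) ≠ 0} := by
      ext x
      exact hi ⟨D, hD⟩ x _ (hv _ x)
    rw [this]
    refine isOpen_induced ?_
    exact isOpen_ne_fun (by fun_prop) continuous_const

/-- Outside `A`, `f` is one more than the least `n` with `x ∈ K n`; on `A` it is `0`. -/
theorem exists_nat_index_of_iUnion_isClopen {X : Type*} [TopologicalSpace X] {A : Set X}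
    (hA : IsClosed A) {K : ℕ → Set X} (hK : ∀ n, IsClopen (K n)) (hAK : Aᶜ = ⋃ n, K n) :
    ∃ f : X → ℕ, f ⁻¹' {0} = A ∧ (∀ n, IsClosed (f ⁻¹' {n})) ∧
      ∀ n, IsOpen (f ⁻¹' {n + 1}) := by
  classical
  have hx : ∀ x, x ∉ A ↔ ∃ n, x ∈ K n := fun x => by
    rw [← Set.mem_compl_iff, hAK, Set.mem_iUnion]
  let f : X → ℕ := fun x => if h : ∃ n, x ∈ K n then Nat.find h + 1 else 0
  have h0 : f ⁻¹' {0} = A := by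
    ext x
    rw [← not_iff_not, hx]
    by_cases h : ∃ n, x ∈ K n <;> simp [f, h]
  have hs : ∀ n, f ⁻¹' {n + 1} = K n \ ⋃ m ∈ Finset.range n, K m := fun n => by
    ext x
    by_cases h : ∃ n, x ∈ K n
    · simp only [f, Set.mem_preimage, Set.mem_singleton_iff, dif_pos h, Nat.add_right_cancel_iff,
        Nat.find_eq_iff, Set.mem_sdiff, Set.mem_iUnion, Finset.mem_range, not_exists]
    · simpa [f, h] using fun h' => absurd ⟨n, h'⟩ h
  have hc : ∀ n, IsClopen (f ⁻¹' {n + 1}) := fun n => by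
    rw [hs]
    exact (hK n).diff (isClopen_biUnion_finset fun m _ => hK m)
  refine ⟨f, h0, fun n => ?_, fun n => (hc n).isOpen⟩
  cases n with
  | zero => rw [h0]; exact hA
  | succ n => exact (hc n).isClosed

theorem exists_iUnion_delta11_compl {A : Set (ℕ → ℕ)} (hA : IsClosed[deltaTopology] A) :
    ∃ K : ℕ → Set (ℕ → ℕ), (∀ n, IsDelta11 (K n)) ∧ Aᶜ = ⋃ n, K n := by
  let := deltaTopology
  obtain ⟨𝒟, h𝒟, hA𝒟⟩ := isTopologicalBasis_deltaTopology.open_eq_sUnion hA.isOpen_compl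
  -- Adding `∅` makes the family nonempty, hence the range of a sequence.
  have hc : (insert ∅ 𝒟).Countable :=
    (countable_isSigma11.mono fun D hD => (h𝒟 hD).1).insert ∅
  obtain ⟨K, hK⟩ := hc.exists_eq_range (Set.insert_nonempty _ _)
  refine ⟨K, fun n => ?_, ?_⟩
  · rcases (hK ▸ Set.mem_range_self n : K n ∈ insert ∅ 𝒟) with h | h
    · exact h ▸ isDelta11_empty
    · exact h𝒟 h
  · rw [hA𝒟, ← Set.sUnion_range, ← hK, Set.sUnion_insert, Set.empty_union]

theorem polishSpace_sigmaDeltaTopology : @PolishSpace (ℕ → ℕ) sigmaDeltaTopology := by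
  let ι := {A : Set (ℕ → ℕ) | IsSigma11 A ∧ IsClosed[deltaTopology] A}
  have : Countable ι := (countable_isSigma11.mono fun A hA => hA.1).to_subtype
  have hex : ∀ A : ι, ∃ f : (ℕ → ℕ) → ℕ, f ⁻¹' {0} = A.1 ∧
      (∀ n, IsClosed[deltaTopology] (f ⁻¹' {n})) ∧
      ∀ n, IsOpen[deltaTopology] (f ⁻¹' {n + 1}) := fun A => by
    obtain ⟨K, hK, hAK⟩ := exists_iUnion_delta11_compl A.2.2
    exact @exists_nat_index_of_iUnion_isClopen _ deltaTopology _ A.2.2 K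
      (fun n => ⟨isClosed_deltaTopology (hK n), isOpen_deltaTopology (hK n)⟩) hAK
  choose f hf0 hfc hfo using hex
  have hpolish := @polishSpace_induced_of_isClosed_graph (ℕ → ℕ) ι (fun _ => ℕ) _ deltaTopology
    polishSpace_deltaTopology _ (fun _ => inferInstance) f
    fun A => @isClosed_graph_of_isClosed_fibers _ deltaTopology _ (hfc A)
  convert hpolish using 1
  -- The fibres of each `f A` are `ΣΔ`-open: the zero fibre is a generator, the others are `Δ`-open.
  -- Conversely each generator is a zero fibre.
  apply le_antisymm
  · rw [← continuous_iff_le_induced]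
    refine @Continuous.prodMk _ _ _ deltaTopology _ sigmaDeltaTopology _ _ ?_ ?_
    · exact continuous_id_iff_le.2 sigmaDeltaTopology_le_deltaTopology
    · refine @continuous_pi _ _ _ sigmaDeltaTopology _ _ fun A => ?_
      refine (@continuous_nat_iff_isOpen_fibers _ sigmaDeltaTopology _).2 fun n => ?_
      cases n with
      | zero =>
        rw [hf0]
        exact TopologicalSpace.isOpen_generateFrom_of_mem A.2
      | succ n => exact sigmaDeltaTopology_le_deltaTopology _ (hfo A n)
  · refine le_generateFrom fun A hA => ?_
    have : A = (fun x : ℕ → ℕ => (x, fun B => f B x)) ⁻¹' (Prod.snd ⁻¹' {y | y ⟨A, hA⟩ = 0}) :=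
      (hf0 ⟨A, hA⟩).symm
    rw [this]
    refine @isOpen_induced _ _ (@instTopologicalSpaceProd _ _ deltaTopology _) _ _ ?_
    refine @IsOpen.preimage _ _ (@instTopologicalSpaceProd _ _ deltaTopology _) _ _
      (@continuous_snd _ _ deltaTopology _) _ ?_
    exact (isOpen_discrete {0}).preimage (continuous_apply (⟨A, hA⟩ : ι))

end EffectiveDST

/-- The lightface `Δ¹₁` sets are a basis of the `Δ`-topology, the `Δ`-closed lightface `Σ¹₁` sets
are a basis of the `ΣΔ`-topology, the latter is finer (in Mathlib: `≤`) than the former, and both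
topologies are Polish. -/
theorem mainTheorem4 :
    @TopologicalSpace.IsTopologicalBasis (ℕ → ℕ) EffectiveDST.deltaTopology
      {D | EffectiveDST.IsDelta11 D} ∧
    @TopologicalSpace.IsTopologicalBasis (ℕ → ℕ) EffectiveDST.sigmaDeltaTopology
      {A | EffectiveDST.IsSigma11 A ∧ @IsClosed (ℕ → ℕ) EffectiveDST.deltaTopology A} ∧
    EffectiveDST.sigmaDeltaTopology ≤ EffectiveDST.deltaTopology ∧
    @PolishSpace (ℕ → ℕ) EffectiveDST.deltaTopology ∧
    @PolishSpace (ℕ → ℕ) EffectiveDST.sigmaDeltaTopology :=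
  ⟨EffectiveDST.isTopologicalBasis_deltaTopology,
    EffectiveDST.isTopologicalBasis_sigmaDeltaTopology,
    EffectiveDST.sigmaDeltaTopology_le_deltaTopology,
    EffectiveDST.polishSpace_deltaTopology, EffectiveDST.polishSpace_sigmaDeltaTopology⟩
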